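/- All rings are commutative with $1$. A ring homomorphism $f\colon A\to B$ is \emph{ind-étale} if it can be written as a filtered colimit of étale ring homomorphisms $f_i\colon A\to B_i$. Its \emph{completely decomposed locus} is the set of points $x\in\operatorname{Spec} B$ such that the induced map of residue fields $\kappa(\operatorname{Spec}(f)(x))\to\kappa(x)$ is an isomorphism, and $f$ is \emph{completely decomposed} if this locus maps onto $\operatorname{Spec} A$, i.e. if over every point of $\operatorname{Spec} A$ there is a point of $\operatorname{Spec} B$ at which the map of residue fields is an isomorphism. An \emph{ind-Nisnevich cover} is a ring homomorphism that is ind-étale and completely decomposed. A ring $A$ is \emph{cdw-contractible} if every ind-Nisnevich cover $f\colon A\to B$ splits, i.e. there is a ring homomorphism $s\colon B\to A$ with $s\circ f=\operatorname{id}_A$. \textbf{Lemma.} Let $A$ be a ring. Then there is an ind-Nisnevich cover $A\to\overline A$ with $\overline A$ a cdw-contractible ring. -/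

import Mathlib

open CategoryTheory

universe u

namespace ProNisnevich

/-- A ring homomorphism `f : A → B` is ind-étale if it is a filtered colimit of étale ring
homomorphisms `fᵢ : A → Bᵢ`. -/
def IsIndEtale {A B : Type u} [CommRing A] [CommRing B] (f : A →+* B) : Prop :=
  MorphismProperty.ind.{u} (RingHom.toMorphismProperty RingHom.Etale) (CommRingCat.ofHom f)

/-- The completely decomposed locus of `Spec B → Spec A`: the points `x` of `Spec B` such that
the map of residue fields `κ(f(x)) → κ(x)` is an isomorphism. -/
def completelyDecomposedLocus {A B : Type u} [CommRing A] [CommRing B] (f : A →+* B) :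
    Set (PrimeSpectrum B) :=
  {x | Function.Bijective
    (Ideal.ResidueField.map (PrimeSpectrum.comap f x).asIdeal x.asIdeal f
      (PrimeSpectrum.comap_asIdeal f x))}

/-- `f` is completely decomposed if its completely decomposed locus maps onto `Spec A`. -/
def IsCompletelyDecomposed {A B : Type u} [CommRing A] [CommRing B] (f : A →+* B) : Prop :=
  PrimeSpectrum.comap f '' completelyDecomposedLocus f = Set.univ

/-- An ind-Nisnevich cover is an ind-étale, completely decomposed ring homomorphism. -/
structure IsIndNisnevichCover {A B : Type u} [CommRing A] [CommRing B] (f : A →+* B) : Prop where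
  isIndEtale : IsIndEtale f
  isCompletelyDecomposed : IsCompletelyDecomposed f

/-- A ring `A` is cdw-contractible if every ind-Nisnevich cover `f : A → B` splits, i.e. has a
retraction `s : B → A` that is a ring homomorphism. -/
def IsCdwContractible (A : Type u) [CommRing A] : Prop :=
  ∀ (B : Type u) [CommRing B] (f : A →+* B), IsIndNisnevichCover f →
    ∃ s : B →+* A, s.comp f = RingHom.id A

end ProNisnevich

namespace ProNisnevich

open Limits TensorProduct

/-! Let `P` be the product of the residue fields of `A`, and let the hull be the colimit of all
étale `A`-algebras over `P`. Fixing presentations keeps the index category small. The projections of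
the hull to the factors of `P` extend the maps `A → κ(x)`, so the hull is an ind-Nisnevich cover. If
`B` is an ind-Nisnevich cover of the hull, each map from the hull to `κ(x)` extends to `B`
(`IsCompletelyDecomposed.exists_extension`), so `B` maps to `P` over the hull. An étale algebra over
the hull with such a map descends to an étale `A`-algebra over `P`, which already occurs in the
colimit; hence it has a unique section over `P` (`existsUnique_section`). Uniqueness makes the
sections of the étale stages of `B` compatible, and they glue to a retraction (`exists_retraction`).
-/

/-- A factorization `A → C → P` of `A → P` with `C` étale over `A`, where `C` is given by
generators and relations. -/
structure EtaleFactorization (A P : Type u) [CommRing A] [CommRing P] [Algebra A P] where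
  /-- The number of generators. -/
  n : ℕ
  /-- The ideal of relations. -/
  I : Ideal (MvPolynomial (Fin n) A)
  etale : Algebra.Etale A (MvPolynomial (Fin n) A ⧸ I)
  /-- The map to `P`. -/
  toP : (MvPolynomial (Fin n) A ⧸ I) →ₐ[A] P

/-! ### The filtered category of étale algebras over `P` -/

namespace EtaleFactorization

variable {A P : Type u} [CommRing A] [CommRing P] [Algebra A P]

noncomputable section

/-- The étale algebra of a factorization. -/
abbrev Ring (C : EtaleFactorization A P) : Type u := MvPolynomial (Fin C.n) A ⧸ C.I

instance (C : EtaleFactorization A P) : Algebra.Etale A C.Ring := C.etale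

/-- Morphisms of factorizations are algebra maps over `P`. -/
@[ext]
structure Hom (C D : EtaleFactorization A P) where
  /-- The underlying algebra map. -/
  hom : C.Ring →ₐ[A] D.Ring
  comp_hom : D.toP.comp hom = C.toP

instance : SmallCategory (EtaleFactorization A P) where
  Hom := Hom
  id C := ⟨.id A _, AlgHom.comp_id _⟩
  comp f g := ⟨g.hom.comp f.hom, by rw [← AlgHom.comp_assoc, g.comp_hom, f.comp_hom]⟩

lemma comp_hom' {C D E : EtaleFactorization A P} (f : C ⟶ D) (g : D ⟶ E) :
    (f ≫ g).hom = g.hom.comp f.hom := rfl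

/-- Every étale algebra over `P` is isomorphic to one given by generators and relations. -/
lemma exists_algEquiv (C : Type u) [CommRing C] [Algebra A C] [Algebra.Etale A C]
    (f : C →ₐ[A] P) :
    ∃ (D : EtaleFactorization A P) (e : C ≃ₐ[A] D.Ring), D.toP.comp e = f := by
  obtain ⟨n, g, hg⟩ := Algebra.FiniteType.iff_quotient_mvPolynomial''.mp
    (inferInstance : Algebra.FiniteType A C)
  let e := Ideal.quotientKerAlgEquivOfSurjective hg
  refine ⟨⟨n, RingHom.ker g, Algebra.Etale.of_equiv e.symm, f.comp e⟩, e.symm, ?_⟩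
  ext x
  simp

/-- Two parallel maps of étale algebras are coequalized by an étale algebra. -/
lemma exists_coequalizer {C D : Type u} [CommRing C] [CommRing D] [Algebra A C] [Algebra A D]
    [Algebra.Etale A C] [Algebra.Etale A D] (f g : C →ₐ[A] D) (p : D →ₐ[A] P)
    (h : p.comp f = p.comp g) :
    ∃ (E : Type u) (_ : CommRing E) (_ : Algebra A E) (_ : Algebra.Etale A E)
      (c : D →ₐ[A] E) (q : E →ₐ[A] P), c.comp f = c.comp g ∧ q.comp c = p := by
  -- The coequalizer is the base change of `D` along the multiplication `C ⊗ C → C`. That map is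
  -- étale, being a map between étale `A`-algebras.
  let m : C ⊗[A] C →ₐ[A] D := Algebra.TensorProduct.productMap f g
  let mul : C ⊗[A] C →ₐ[A] C := Algebra.TensorProduct.productMap (.id A C) (.id A C)
  let : Algebra (C ⊗[A] C) D := m.toRingHom.toAlgebra
  let : Algebra (C ⊗[A] C) C := mul.toRingHom.toAlgebra
  have : IsScalarTower A (C ⊗[A] C) D := .of_algebraMap_eq fun x ↦ (m.commutes x).symm
  have : IsScalarTower A (C ⊗[A] C) C := .of_algebraMap_eq fun x ↦ (mul.commutes x).symm
  have : Algebra.Etale A (C ⊗[A] C) := .comp A C _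
  have : Algebra.Etale (C ⊗[A] C) C := .of_restrictScalars A _ _
  have : Algebra.Etale A (D ⊗[C ⊗[A] C] C) := .comp A D _
  let : Algebra (C ⊗[A] C) P := (p.comp m).toRingHom.toAlgebra
  have : IsScalarTower A (C ⊗[A] C) P := .of_algebraMap_eq fun x ↦ ((p.comp m).commutes x).symm
  let p' : D →ₐ[C ⊗[A] C] P := { p with commutes' := fun x ↦ rfl }
  let r' : C →ₐ[C ⊗[A] C] P := { p.comp f with
    commutes' := fun x ↦ by
      have : (p.comp f).comp mul = p.comp m := by
        ext x
        · simp [m, mul]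
        · simpa [m, mul] using DFunLike.congr_fun h x
      exact DFunLike.congr_fun this x }
  refine ⟨D ⊗[C ⊗[A] C] C, inferInstance, inferInstance, inferInstance,
    Algebra.TensorProduct.includeLeft,
    (Algebra.TensorProduct.productMap p' r').restrictScalars A, ?_, ?_⟩
  · ext x
    have h1 : (f x) = algebraMap (C ⊗[A] C) D (x ⊗ₜ 1) := by
      change _ = m _
      simp [m]
    have h2 : (g x) = algebraMap (C ⊗[A] C) D (1 ⊗ₜ x) := by
      change _ = m _
      simp [m]
    have h3 : algebraMap (C ⊗[A] C) C (x ⊗ₜ 1) = algebraMap (C ⊗[A] C) C (1 ⊗ₜ x) := by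
      change mul _ = mul _
      simp [mul]
    simp only [AlgHom.comp_apply, Algebra.TensorProduct.includeLeft_apply]
    rw [h1, h2, Algebra.TensorProduct.tmul_one_eq_one_tmul,
      Algebra.TensorProduct.tmul_one_eq_one_tmul, h3]
  · ext x
    simp [p']

instance : IsFiltered (EtaleFactorization A P) where
  nonempty := by
    obtain ⟨D, -, -⟩ := exists_algEquiv (A := A) (P := P) A (Algebra.ofId A P)
    exact ⟨D⟩
  cocone_objs C D := by
    have : Algebra.Etale A (C.Ring ⊗[A] D.Ring) := .comp A C.Ring _
    obtain ⟨E, e, he⟩ := exists_algEquiv (C.Ring ⊗[A] D.Ring)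
      (Algebra.TensorProduct.productMap C.toP D.toP)
    refine ⟨E, ⟨e.toAlgHom.comp Algebra.TensorProduct.includeLeft, ?_⟩,
      ⟨e.toAlgHom.comp Algebra.TensorProduct.includeRight, ?_⟩, trivial⟩
    · refine .trans ?_ (Algebra.TensorProduct.productMap_left C.toP D.toP)
      rw [← AlgHom.comp_assoc]
      exact congrArg (AlgHom.comp · _) he
    · refine .trans ?_ (Algebra.TensorProduct.productMap_right C.toP D.toP)
      rw [← AlgHom.comp_assoc]
      exact congrArg (AlgHom.comp · _) he
  cocone_maps C D f g := by
    obtain ⟨E, _, _, _, c, q, hc, hq⟩ := exists_coequalizer f.hom g.hom D.toP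
      (f.comp_hom.trans g.comp_hom.symm)
    obtain ⟨E', e, he⟩ := exists_algEquiv E q
    refine ⟨E', ⟨e.toAlgHom.comp c, ?_⟩, ?_⟩
    · rw [← AlgHom.comp_assoc]
      exact (congrArg (AlgHom.comp · c) he).trans hq
    · apply Hom.ext
      rw [comp_hom', comp_hom', AlgHom.comp_assoc, hc, AlgHom.comp_assoc]

end

end EtaleFactorization
end ProNisnevich

/-! ### The hull and sections of étale algebras over it -/

namespace ProNisnevich

open Limits TensorProduct

namespace EtaleFactorization

variable (A P : Type u) [CommRing A] [CommRing P] [Algebra A P]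

noncomputable section

/-- The diagram of all étale factorizations. -/
def diagram : EtaleFactorization A P ⥤ CommRingCat.{u} where
  obj C := .of C.Ring
  map f := CommRingCat.ofHom f.hom.toRingHom

/-- The structure maps from `A` to the diagram of étale factorizations. -/
def structureMap : (Functor.const _).obj (CommRingCat.of A) ⟶ diagram A P where
  app C := CommRingCat.ofHom (algebraMap A C.Ring)
  naturality C D f := by
    ext x
    exact (f.hom.commutes x).symm

/-- The maps to `P` form a cocone. -/
def coconeP : Cocone (diagram A P) where
  pt := .of P
  ι := { app C := CommRingCat.ofHom C.toP.toRingHom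
         naturality C D f := by
           ext x
           exact DFunLike.congr_fun f.comp_hom x }

end

end EtaleFactorization

open EtaleFactorization

variable (A P : Type u) [CommRing A] [CommRing P] [Algebra A P]

noncomputable section

/-- The colimit of all étale `A`-algebras equipped with a map to `P`. -/
abbrev IndEtaleHull : Type u := (colimit (diagram A P) : CommRingCat.{u})

namespace IndEtaleHull

variable {A P}

/-- The canonical map of a factorization into the hull, as a ring homomorphism. -/
def ιRingHom (C : EtaleFactorization A P) : C.Ring →+* IndEtaleHull A P :=
  (colimit.ι (diagram A P) C).hom

lemma ιRingHom_comp {C D : EtaleFactorization A P} (f : C ⟶ D) :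
    (ιRingHom D).comp f.hom.toRingHom = ιRingHom C :=
  congrArg CommRingCat.Hom.hom (colimit.w (diagram A P) f)

lemma ιRingHom_comp_algebraMap (C D : EtaleFactorization A P) :
    (ιRingHom C).comp (algebraMap A C.Ring) = (ιRingHom D).comp (algebraMap A D.Ring) := by
  have key {C D : EtaleFactorization A P} (f : C ⟶ D) :
      (ιRingHom C).comp (algebraMap A C.Ring) = (ιRingHom D).comp (algebraMap A D.Ring) := by
    rw [← ιRingHom_comp f, RingHom.comp_assoc]
    exact congrArg _ f.hom.comp_algebraMap
  exact (key (IsFiltered.leftToMax C D)).trans (key (IsFiltered.rightToMax C D)).symm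

/-- The chosen stage is immaterial: any two stages map to a common one. -/
instance : Algebra A (IndEtaleHull A P) :=
  ((ιRingHom IsFiltered.nonempty.some).comp (algebraMap A _)).toAlgebra

/-- The canonical map of a factorization into the hull. -/
def ι (C : EtaleFactorization A P) : C.Ring →ₐ[A] IndEtaleHull A P where
  __ := ιRingHom C
  commutes' x := RingHom.congr_fun (ιRingHom_comp_algebraMap C _) x

lemma ι_comp {C D : EtaleFactorization A P} (f : C ⟶ D) : (ι D).comp f.hom = ι C :=
  AlgHom.coe_ringHom_injective (ιRingHom_comp f)

variable (A P) in
/-- The canonical map from the hull to `P`. -/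
def toP : IndEtaleHull A P →ₐ[A] P where
  __ := (colimit.desc (diagram A P) (coconeP A P)).hom
  commutes' x := by
    have h (C : EtaleFactorization A P) (y : C.Ring) :
        (colimit.desc (diagram A P) (coconeP A P)).hom (ιRingHom C y) = C.toP y :=
      RingHom.congr_fun
        (congrArg CommRingCat.Hom.hom (colimit.ι_desc (coconeP A P) C)) y
    exact (h _ _).trans ((IsFiltered.nonempty.some : EtaleFactorization A P).toP.commutes x)

lemma toP_comp_ι (C : EtaleFactorization A P) : (toP A P).comp (ι C) = C.toP :=
  AlgHom.coe_ringHom_injective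
    (congrArg CommRingCat.Hom.hom (colimit.ι_desc (coconeP A P) C))

/-- A finitely presented algebra maps to the hull through a finite stage. -/
lemma exists_factor {R S : Type u} [CommRing R] [CommRing S] (f : R →+* S)
    (hf : f.FinitePresentation) (a : ∀ C : EtaleFactorization A P, R →+* C.Ring)
    (ha : ∀ {C D : EtaleFactorization A P} (h : C ⟶ D), h.hom.toRingHom.comp (a C) = a D)
    (g : S →+* IndEtaleHull A P) (hg : ∀ C, g.comp f = (ιRingHom C).comp (a C)) :
    ∃ (C : EtaleFactorization A P) (g' : S →+* C.Ring),
      g'.comp f = a C ∧ (ιRingHom C).comp g' = g := by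
  obtain ⟨C, g', h1, h2⟩ := RingHom.EssFiniteType.exists_eq_comp_ι_app_of_isColimit
    (CommRingCat.of R) (diagram A P)
    { app C := CommRingCat.ofHom (a C)
      naturality C D h := by
        ext x
        exact (RingHom.congr_fun (ha h) x).symm }
    (CommRingCat.ofHom f) (colimit.cocone (diagram A P)) (colimit.isColimit _) hf
    (CommRingCat.ofHom g) (fun C ↦ CommRingCat.hom_ext (hg C))
  exact ⟨C, g'.hom, congrArg CommRingCat.Hom.hom h1, (congrArg CommRingCat.Hom.hom h2).symm⟩

/-- An étale `A`-algebra over `P` maps uniquely to the hull over `P`. -/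
lemma existsUnique_algHom (C : Type u) [CommRing C] [Algebra A C] [Algebra.Etale A C]
    (f : C →ₐ[A] P) : ∃! s : C →ₐ[A] IndEtaleHull A P, (toP A P).comp s = f := by
  obtain ⟨D, e, he⟩ := exists_algEquiv C f
  refine ⟨(ι D).comp e, ?_, ?_⟩
  · dsimp only
    rw [← AlgHom.comp_assoc, toP_comp_ι, he]
  · intro s hs
    -- By finite presentation `s` factors through a stage `E`. The factorization is a morphism `D ⟶
    -- E` over `P`, so the colimit identifies `s` with the canonical map.
    obtain ⟨E, g, hg, hgs⟩ := exists_factor (A := A) (P := P) (algebraMap A C)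
      (RingHom.finitePresentation_algebraMap.mpr inferInstance) (fun C ↦ algebraMap A C.Ring)
      (fun h ↦ h.hom.comp_algebraMap) s.toRingHom
      (fun C ↦ s.comp_algebraMap.trans (ι C).comp_algebraMap.symm)
    let g' : C →ₐ[A] E.Ring := { g with commutes' := RingHom.congr_fun hg }
    have hg' : (ι E).comp g' = s := AlgHom.coe_ringHom_injective hgs
    let h : D ⟶ E := ⟨g'.comp e.symm, by
      rw [← toP_comp_ι E, ← AlgHom.comp_assoc, AlgHom.comp_assoc _ _ g', hg', hs, ← he]
      ext x; simp⟩
    rw [← ι_comp h, ← hg']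
    ext x
    simp [h]

/-- Compatible ring homomorphisms factor through the tensor product. -/
lemma _root_.Algebra.TensorProduct.exists_ringHom {R S B T : Type*} [CommRing R] [CommRing S]
    [CommRing B] [CommRing T] [Algebra R S] [Algebra R B] (a : S →+* T) (b : B →+* T)
    (h : a.comp (algebraMap R S) = b.comp (algebraMap R B)) :
    ∃ l : S ⊗[R] B →+* T, (∀ x, l (x ⊗ₜ 1) = a x) ∧ ∀ y, l (1 ⊗ₜ y) = b y := by
  let : Algebra R T := (a.comp (algebraMap R S)).toAlgebra
  let a' : S →ₐ[R] T := { a with commutes' := fun _ ↦ rfl }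
  let b' : B →ₐ[R] T := { b with commutes' := fun x ↦ (RingHom.congr_fun h x).symm }
  exact ⟨(Algebra.TensorProduct.productMap a' b').toRingHom,
    fun x ↦ by simp [a'], fun y ↦ by simp [b']⟩

/-- A ring homomorphism from a ring of finite type over `ℤ` to the hull factors through an étale
`A`-algebra. -/
lemma exists_etale_factor (R : Type u) [CommRing R] [Algebra.FiniteType ℤ R]
    (f : R →+* IndEtaleHull A P) :
    ∃ (C : Type u) (_ : CommRing C) (_ : Algebra A C) (_ : Algebra.Etale A C)
      (i : C →ₐ[A] IndEtaleHull A P) (g : R →+* C), i.toRingHom.comp g = f := by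
  have : Algebra.FinitePresentation ℤ R := Algebra.FinitePresentation.of_finiteType.mp ‹_›
  -- `ULift` places `ℤ` in universe `u`; initiality makes all compatibility conditions automatic.
  let z (S : Type u) [CommRing S] : ULift.{u} ℤ →+* S :=
    (Int.castRingHom S).comp (ULift.ringEquiv : ULift.{u} ℤ ≃+* ℤ).toRingHom
  have hz {S : Type u} [CommRing S] (a b : ULift.{u} ℤ →+* S) : a = b := by
    have := RingHom.ext_int (a.comp (ULift.ringEquiv : ULift.{u} ℤ ≃+* ℤ).symm.toRingHom)
      (b.comp (ULift.ringEquiv : ULift.{u} ℤ ≃+* ℤ).symm.toRingHom)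
    ext x
    exact RingHom.congr_fun this x.down
  obtain ⟨C, g, -, hg⟩ := exists_factor (A := A) (P := P) (z R)
    (.comp (RingHom.finitePresentation_algebraMap.mpr this : (algebraMap ℤ R).FinitePresentation)
      (.of_bijective (ULift.ringEquiv : ULift.{u} ℤ ≃+* ℤ).bijective))
    (fun C ↦ z C.Ring) (fun _ ↦ hz _ _) f (fun _ ↦ hz _ _)
  exact ⟨C.Ring, inferInstance, inferInstance, inferInstance, ι C, g, hg⟩

/-- An étale algebra over the hull, with a map to `P`, has a unique section over `P`. -/
lemma existsUnique_section (B : Type u) [CommRing B] [Algebra (IndEtaleHull A P) B]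
    [Algebra.Etale (IndEtaleHull A P) B] (f : B →+* P)
    (hf : f.comp (algebraMap (IndEtaleHull A P) B) = (toP A P).toRingHom) :
    ∃! s : B →ₐ[IndEtaleHull A P] IndEtaleHull A P,
      (toP A P).toRingHom.comp s.toRingHom = f := by
  -- `B` is the base change of an étale `B₀` over a finitely generated subring `R`. Since `R` maps
  -- to the hull through an étale `A`-algebra `C`, the algebra `C ⊗[R] B₀` is étale over `A`.
  obtain ⟨R, B₀, _, _, hR, _, ⟨e⟩⟩ :=
    Algebra.Etale.exists_subalgebra_fg ℤ (IndEtaleHull A P) B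
  have : Algebra.FiniteType ℤ R := (Subalgebra.fg_iff_finiteType R).mp hR
  obtain ⟨C, _, _, _, i, g, hg⟩ := exists_etale_factor R R.val.toRingHom
  let : Algebra R C := g.toAlgebra
  let D := C ⊗[R] B₀
  have : Algebra.Etale A D := .comp A C D
  let jHom : B₀ →+* B := e.symm.toAlgHom.toRingHom.comp
    (Algebra.TensorProduct.includeRight : B₀ →ₐ[R] IndEtaleHull A P ⊗[R] B₀).toRingHom
  have hgC (r : R) : i (g r) = r := RingHom.congr_fun hg r
  have hj (r : R) : jHom (algebraMap R B₀ r) = algebraMap (IndEtaleHull A P) B r := by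
    rw [← e.symm.commutes, Algebra.TensorProduct.algebraMap_apply]
    exact congrArg e.symm (Algebra.TensorProduct.tmul_one_eq_one_tmul r).symm
  have hι (t : C →ₐ[A] IndEtaleHull A P) (ht : (toP A P).comp t = (toP A P).comp i) : t = i :=
    (existsUnique_algHom C _).unique ht rfl
  obtain ⟨q, hq1, hq2⟩ := Algebra.TensorProduct.exists_ringHom (R := R)
    ((toP A P).comp i).toRingHom (f.comp jHom) <| by
      ext r
      change toP A P (i (g r)) = f (jHom (algebraMap R B₀ r))
      rw [hj, hgC]
      exact (RingHom.congr_fun hf r).symm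
  let qA : D →ₐ[A] P := { q with commutes' := fun x ↦ (hq1 _).trans (((toP A P).comp i).commutes x) }
  refine existsUnique_of_exists_of_unique ?_ ?_
  · obtain ⟨t, ht, -⟩ := existsUnique_algHom D qA
    -- Uniqueness on `C` forces `t` to restrict to `i`, so `t` on `B₀` is compatible with the
    -- inclusion of `R` and glues with the identity of the hull.
    have htC : t.comp Algebra.TensorProduct.includeLeft = i := hι _ <| by
      rw [← AlgHom.comp_assoc, ht]
      exact AlgHom.ext hq1
    obtain ⟨l, hl1, hl2⟩ := Algebra.TensorProduct.exists_ringHom (R := R)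
      (RingHom.id (IndEtaleHull A P)) (t.toRingHom.comp
        (Algebra.TensorProduct.includeRight : B₀ →ₐ[R] D).toRingHom) <| by
      ext r
      change (r : IndEtaleHull A P) = t (1 ⊗ₜ algebraMap R B₀ r)
      rw [← hgC r, ← htC, ← Algebra.TensorProduct.tmul_one_eq_one_tmul]
      rfl
    refine ⟨{ l.comp e.toAlgHom.toRingHom with commutes' := fun x ↦ ?_ }, ?_⟩
    · exact (congrArg l (e.commutes x)).trans (hl1 x)
    · have : ((toP A P).toRingHom.comp l) = f.comp e.symm.toAlgHom.toRingHom := by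
        refine Algebra.TensorProduct.ringHom_ext (RingHom.ext fun x ↦ ?_) (RingHom.ext fun y ↦ ?_)
        · refine (congrArg (toP A P) (hl1 x)).trans ?_
          refine (RingHom.congr_fun hf x).symm.trans (congrArg f (e.symm.commutes x).symm)
        · refine (congrArg (toP A P) (hl2 y)).trans ?_
          exact (DFunLike.congr_fun ht (1 ⊗ₜ y)).trans (hq2 y)
      ext x
      exact (RingHom.congr_fun this (e x)).trans (congrArg f (e.symm_apply_apply x))
  -- A section is determined by its values on `B₀`, hence by the induced map `D → IndEtaleHull A P`
  -- over `P`, which is unique.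
  · have key (s : B →ₐ[IndEtaleHull A P] IndEtaleHull A P)
        (hs : (toP A P).toRingHom.comp s.toRingHom = f) :
        ∃ t : D →ₐ[A] IndEtaleHull A P, (toP A P).comp t = qA ∧
          ∀ y, t (1 ⊗ₜ y) = s (jHom y) := by
      obtain ⟨l, hl1, hl2⟩ := Algebra.TensorProduct.exists_ringHom (R := R)
        (i).toRingHom (s.toRingHom.comp jHom) <| by
          ext r
          change i (g r) = s (jHom (algebraMap R B₀ r))
          rw [hgC, hj]
          exact (s.commutes _).symm
      refine ⟨{ l with commutes' := fun x ↦ (hl1 _).trans ((i).commutes x) }, ?_, hl2⟩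
      have : (toP A P).toRingHom.comp l = q := by
        refine Algebra.TensorProduct.ringHom_ext (RingHom.ext fun x ↦ ?_) (RingHom.ext fun y ↦ ?_)
        · exact (congrArg (toP A P) (hl1 x)).trans
            (hq1 x).symm
        · exact (congrArg (toP A P) (hl2 y)).trans
            ((RingHom.congr_fun hs (jHom y)).trans (hq2 y).symm)
      exact AlgHom.coe_ringHom_injective this
    intro s s' hs hs'
    obtain ⟨t, ht, hts⟩ := key s hs
    obtain ⟨t', ht', hts'⟩ := key s' hs'
    obtain rfl := (existsUnique_algHom D qA).unique ht ht'
    have : s.toRingHom.comp e.symm.toAlgHom.toRingHom =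
        s'.toRingHom.comp e.symm.toAlgHom.toRingHom := by
      refine Algebra.TensorProduct.ringHom_ext (RingHom.ext fun x ↦ ?_) (RingHom.ext fun y ↦ ?_)
      · exact (congrArg s (e.symm.commutes x)).trans ((s.commutes x).trans
          ((s'.commutes x).symm.trans (congrArg s' (e.symm.commutes x)).symm))
      · exact (hts y).symm.trans (hts' y)
    ext x
    obtain ⟨x, rfl⟩ := e.symm.surjective x
    exact RingHom.congr_fun this x

end IndEtaleHull
end
end ProNisnevich

/-! ### Retractions of ind-étale algebras over the hull -/

namespace ProNisnevich

open Limits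

namespace IndEtaleHull

variable {A P : Type u} [CommRing A] [CommRing P] [Algebra A P]

variable (A P) in
lemma isIndEtale_algebraMap : IsIndEtale (algebraMap A (IndEtaleHull A P)) := by
  refine ⟨EtaleFactorization A P, inferInstance, inferInstance, EtaleFactorization.diagram A P,
    EtaleFactorization.structureMap A P, (colimit.cocone (EtaleFactorization.diagram A P)).ι,
    colimit.isColimit _, fun C ↦ ⟨?_, ?_⟩⟩
  · exact RingHom.etale_algebraMap.mpr C.etale
  · exact CommRingCat.hom_ext (ι C).comp_algebraMap

lemma existsUnique_ringHom_section {B : Type u} [CommRing B] (t : IndEtaleHull A P →+* B)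
    (ht : t.Etale) (f : B →+* P) (hf : f.comp t = (toP A P).toRingHom) :
    ∃! s : B →+* IndEtaleHull A P, s.comp t = .id _ ∧ (toP A P).toRingHom.comp s = f := by
  let := t.toAlgebra
  have : Algebra.Etale (IndEtaleHull A P) B := ht
  obtain ⟨s, hs, huniq⟩ := existsUnique_section B f hf
  refine ⟨s.toRingHom, ⟨s.comp_algebraMap, hs⟩, fun s' hs' ↦ ?_⟩
  exact congrArg (fun a : B →ₐ[IndEtaleHull A P] IndEtaleHull A P ↦ a.toRingHom)
    (huniq { s' with commutes' := RingHom.congr_fun hs'.1 } hs'.2)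

/-- An ind-étale algebra over the hull that maps to `P` has a retraction. -/
lemma exists_retraction {B : Type u} [CommRing B] (t : IndEtaleHull A P →+* B)
    (ht : IsIndEtale t) (f : B →+* P) (hf : f.comp t = (toP A P).toRingHom) :
    ∃ s : B →+* IndEtaleHull A P, s.comp t = .id _ := by
  obtain ⟨J, _, _, D, a, b, hb, hab⟩ := ht
  have hab' (j : J) : (b.app j).hom.comp (a.app j).hom = t :=
    congrArg CommRingCat.Hom.hom (hab j).2
  choose s hs huniq using fun j ↦ existsUnique_ringHom_section (a.app j).hom (hab j).1
    (f.comp (b.app j).hom) (by rw [RingHom.comp_assoc, hab', hf])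
  let c : Cocone D :=
    { pt := .of (IndEtaleHull A P)
      ι := { app j := CommRingCat.ofHom (s j)
             naturality i j h := by
               apply CommRingCat.hom_ext
               have ha : (D.map h).hom.comp (a.app i).hom = (a.app j).hom :=
                 (congrArg CommRingCat.Hom.hom (a.naturality h)).symm
               have hb' : (b.app j).hom.comp (D.map h).hom = (b.app i).hom :=
                 congrArg CommRingCat.Hom.hom (b.naturality h)
               -- Restricting `s j` to stage `i` gives another section over `P`, which must be `s
               -- i`.
               refine huniq i ((s j).comp (D.map h).hom) ⟨?_, ?_⟩
               · rw [RingHom.comp_assoc, ha, (hs j).1]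
               · rw [← RingHom.comp_assoc, (hs j).2, RingHom.comp_assoc, hb'] } }
  let j : J := IsFiltered.nonempty.some
  refine ⟨(hb.desc c).hom, ?_⟩
  rw [← hab' j, ← RingHom.comp_assoc]
  exact (congrArg (RingHom.comp · (a.app j).hom)
    (congrArg CommRingCat.Hom.hom (hb.fac c j))).trans (hs j).1

end IndEtaleHull

/-! ### Complete decomposition and maps to fields -/

section ResidueFields

variable {A B : Type u} [CommRing A] [CommRing B]

/-- A map to a field factors through the residue field at its kernel. -/
lemma _root_.Ideal.ResidueField.exists_lift {K : Type u} [Field K] (φ : B →+* K) (y : Ideal B)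
    [y.IsPrime] (hy : RingHom.ker φ = y) :
    ∃ l : y.ResidueField →+* K, l.comp (algebraMap B y.ResidueField) = φ :=
  have h : y.primeCompl ≤ (IsUnit.submonoid K).comap φ := fun _ hb ↦
    isUnit_iff_ne_zero.mpr fun h ↦ hb (hy ▸ RingHom.mem_ker.mpr h)
  ⟨Ideal.ResidueField.lift y φ hy.ge h,
    RingHom.ext fun b ↦ Ideal.ResidueField.lift_algebraMap y φ hy.ge h b⟩

/-- The map `φ` induces a left inverse of `κ(x) → κ(y)`; as a map of fields it is injective, hence a
two-sided inverse. -/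
lemma mem_completelyDecomposedLocus (f : A →+* B) (y : PrimeSpectrum B) (x : PrimeSpectrum A)
    (hx : PrimeSpectrum.comap f y = x) (φ : B →+* x.asIdeal.ResidueField)
    (hφ : φ.comp f = algebraMap A x.asIdeal.ResidueField) (hy : RingHom.ker φ = y.asIdeal) :
    y ∈ completelyDecomposedLocus f := by
  subst hx
  obtain ⟨l, hl⟩ := Ideal.ResidueField.exists_lift φ y.asIdeal hy
  have h : l.comp (Ideal.ResidueField.map (PrimeSpectrum.comap f y).asIdeal y.asIdeal f
      (PrimeSpectrum.comap_asIdeal f y)) = .id _ := by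
    refine Ideal.ResidueField.ringHom_ext (RingHom.ext fun a ↦ ?_)
    simp only [RingHom.comp_apply, Ideal.ResidueField.map_algebraMap]
    exact (RingHom.congr_fun hl (f a)).trans (RingHom.congr_fun hφ a)
  exact ⟨RingHom.injective _, fun z ↦ ⟨l z, l.injective (RingHom.congr_fun h (l z))⟩⟩

/-- A ring homomorphism is completely decomposed if `A → κ(x)` extends to `B` for all `x`. -/
lemma isCompletelyDecomposed_of_extension (f : A →+* B)
    (h : ∀ x : PrimeSpectrum A, ∃ φ : B →+* x.asIdeal.ResidueField,
      φ.comp f = algebraMap A x.asIdeal.ResidueField) : IsCompletelyDecomposed f := by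
  refine Set.eq_univ_of_forall fun x ↦ ?_
  obtain ⟨φ, hφ⟩ := h x
  have hx : PrimeSpectrum.comap f ⟨RingHom.ker φ, RingHom.ker_isPrime φ⟩ = x := by
    refine PrimeSpectrum.ext ?_
    rw [PrimeSpectrum.comap_asIdeal, RingHom.comap_ker, hφ, Ideal.ker_algebraMap_residueField]
  exact ⟨_, mem_completelyDecomposedLocus f _ x hx φ hφ rfl, hx⟩

/-- Maps to fields extend along completely decomposed ring homomorphisms. -/
lemma IsCompletelyDecomposed.exists_extension {f : A →+* B} (hf : IsCompletelyDecomposed f)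
    {K : Type u} [Field K] (φ : A →+* K) : ∃ ψ : B →+* K, ψ.comp f = φ := by
  obtain ⟨z, hz, hzx⟩ := hf.ge (Set.mem_univ ⟨RingHom.ker φ, RingHom.ker_isPrime φ⟩)
  obtain ⟨l, hl⟩ := Ideal.ResidueField.exists_lift φ (PrimeSpectrum.comap f z).asIdeal
    (congrArg PrimeSpectrum.asIdeal hzx).symm
  -- Inverting the isomorphism of residue fields at `z` sends `B` to the residue field below, which
  -- maps to `K`.
  let e := RingEquiv.ofBijective _ hz
  refine ⟨l.comp (e.symm.toRingHom.comp (algebraMap B z.asIdeal.ResidueField)), ?_⟩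
  rw [← hl]
  ext a
  refine congrArg l (e.injective ((e.apply_symm_apply _).trans ?_))
  exact (Ideal.ResidueField.map_algebraMap _ _ f _ a).symm

end ResidueFields

end ProNisnevich

theorem mainTheorem3 (A : Type u) [CommRing A] :
    ∃ (Abar : Type u) (_ : CommRing Abar) (f : A →+* Abar),
      ProNisnevich.IsIndNisnevichCover f ∧ ProNisnevich.IsCdwContractible Abar := by
  let P := ∀ x : PrimeSpectrum A, x.asIdeal.ResidueField
  let p := ProNisnevich.IndEtaleHull.toP A P
  refine ⟨ProNisnevich.IndEtaleHull A P, inferInstance, algebraMap A _,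
    ⟨ProNisnevich.IndEtaleHull.isIndEtale_algebraMap A P,
      ProNisnevich.isCompletelyDecomposed_of_extension _ fun x ↦
        ⟨(Pi.evalRingHom _ x).comp p.toRingHom, ?_⟩⟩, fun B _ f hf ↦ ?_⟩
  · ext a
    exact congrFun (p.commutes a) x
  -- Only the points of the hull given by kernels of its maps to the `κ(x)` are used here.
  · choose ψ hψ using fun x : PrimeSpectrum A ↦
      hf.isCompletelyDecomposed.exists_extension ((Pi.evalRingHom _ x).comp p.toRingHom)
    refine ProNisnevich.IndEtaleHull.exists_retraction f hf.isIndEtale (RingHom.pi ψ) ?_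
    ext a x
    exact RingHom.congr_fun (hψ x) a
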